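/- Conventions. Powers $\nu^a$ with complex $a$ are taken with the principal branch of the logarithm (imaginary part in $(-\pi,\pi]$), and $\zeta$ is the Riemann zeta function. For a complex polynomial $p$ let $P$ be the unique polynomial with $\sum_{\nu=1}^{n}p(\nu)=P(n)$ for all $n\in\mathbb N$, and for $a,b\in\mathbb C$ put $\overset{\leftrightarrow}{\sum}{}_{\nu=a}^{b}\,p(\nu):=P(b)-P(a-1)$. Let $U\subset\mathbb C$ satisfy $U+1\subset U$. A function $f\colon U\to\mathbb C$ is a right approximate polynomial of degree $\sigma\in\mathbb N\cup\{-\infty\}$ if there are polynomials $(p_n)_{n\in\mathbb N}$, all of degree $\sigma$, with $|f(n+x)-p_n(n+x)|\to0$ as $n\to\infty$ for every $x\in U$. It is right summable if moreover for all $a,b$ with $a\in U$ and $b+1\in U$ the limit $$\overset{\rightarrow}{\sum_{\nu=a}^{b}} f(\nu):=\lim_{n\to\infty}\Bigl(\overset{\leftrightarrow}{\sum_{\nu=n+a}^{n+b}}p_n(\nu)+\sum_{\nu=1}^{n}\bigl(f(\nu+a-1)-f(\nu+b)\bigr)\Bigr)$$ exists; its value, the fractional sum of $f$ from $a$ to $b$,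 does not depend on the choice of $\sigma$ and $(p_n)$. Statement. For every $a\in\mathbb C\setminus\{-1\}$ the function $\nu\mapsto\nu^a$ on $\mathbb C\setminus\{0,-1,-2,\dots\}$ is right summable, and $$\overset{\rightarrow}{\sum_{\nu=1}^{-1/2}}\nu^a=\left(2-2^{-a}\right)\zeta(-a).$$ For every positive integer $n$ the function $\nu\mapsto\nu^{2n}$ on the same domain is right summable, and $$\overset{\rightarrow}{\sum_{\nu=1}^{-1/2}}\nu^{2n}=0.$$ -/

import Mathlib

open Filter Topology Polynomial

/-- For every complex polynomial `p` there is exactly one polynomial `P` with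
`p(1) + ... + p(n) = P(n)` for all natural numbers `n`. -/
theorem existsUnique_polySummation (p : ℂ[X]) :
    ∃! P : ℂ[X], ∀ n : ℕ, ∑ ν ∈ Finset.Icc 1 n, p.eval (ν : ℂ) = P.eval (n : ℂ) := by
  refine existsUnique_of_exists_of_unique ?_ ?_
  · induction p using Polynomial.induction_on' with
    | add p q hp hq =>
      obtain ⟨P, hP⟩ := hp
      obtain ⟨Q, hQ⟩ := hq
      refine ⟨P + Q, fun n => ?_⟩
      simp only [eval_add, Finset.sum_add_distrib, hP, hQ]
    | monomial k c =>
      let B : ℂ[X] := (Polynomial.bernoulli (k + 1)).map (algebraMap ℚ ℂ)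
      refine ⟨C (c / ((k : ℂ) + 1)) *
        (B.comp (X + 1) - C (B.eval 1)), fun n => ?_⟩
      have hk : (k : ℂ) + 1 ≠ 0 := by exact_mod_cast Nat.succ_ne_zero k
      have hB : ∀ m : ℕ, B.eval ((m : ℂ) + 1) = B.eval (m : ℂ) + ((k : ℂ) + 1) * (m : ℂ) ^ k := by
        intro m
        have h := Polynomial.bernoulli_eval_one_add (k + 1) (m : ℚ)
        have h1 : ∀ x : ℚ, B.eval (x : ℂ) = (((Polynomial.bernoulli (k + 1)).eval x : ℚ) : ℂ) := by
          intro x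
          exact Polynomial.eval_map_apply (algebraMap ℚ ℂ) x
        have h2 := h1 (1 + (m : ℚ))
        rw [h] at h2
        have h3 := h1 (m : ℚ)
        push_cast at h2 h3
        rw [add_comm (m : ℂ) 1, h2, h3]
      induction n with
      | zero => simp
      | succ n ih =>
        rw [Finset.sum_Icc_succ_top (by omega), ih]
        have h := hB (n + 1)
        push_cast at h
        simp only [eval_mul, eval_C, eval_sub, eval_comp, eval_add, eval_X, eval_one,
          eval_monomial]
        push_cast
        rw [h]
        field_simp
        ring
  · intro P Q hP hQ
    refine Polynomial.eq_of_infinite_eval_eq P Q ?_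
    refine (Set.infinite_range_of_injective (Nat.cast_injective (R := ℂ))).mono ?_
    rintro _ ⟨n, rfl⟩
    exact (hP n).symm.trans (hQ n)

/-- The unique polynomial `P` with `p(1) + ... + p(n) = P(n)` for all natural numbers `n`. -/
noncomputable def polySummation (p : ℂ[X]) : ℂ[X] :=
  (existsUnique_polySummation p).choose

theorem polySummation_spec (p : ℂ[X]) (n : ℕ) :
    ∑ ν ∈ Finset.Icc 1 n, p.eval (ν : ℂ) = (polySummation p).eval (n : ℂ) :=
  (existsUnique_polySummation p).choose_spec.1 n

/-- The fractional sum of a polynomial `p` from `a` to `b`, for arbitrary complex `a` and `b`: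
`P(b) - P(a - 1)` with `P = polySummation p`. -/
noncomputable def polyFracSum (p : ℂ[X]) (a b : ℂ) : ℂ :=
  (polySummation p).eval b - (polySummation p).eval (a - 1)

/-- The function `f` on the set `U` (its values outside `U` play no role) is a right approximate
polynomial of degree `σ`, with approximating polynomials `p n`. The degree of the zero polynomial
is `⊥`, that is, `-∞`. -/
structure IsRightApproxBy (U : Set ℂ) (f : ℂ → ℂ) (σ : WithBot ℕ) (p : ℕ → ℂ[X]) : Prop where
  add_one_mem : ∀ u ∈ U, u + 1 ∈ U
  degree_eq : ∀ n, (p n).degree = σ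
  approx : ∀ x ∈ U, Tendsto (fun n : ℕ => ‖f (n + x) - (p n).eval (n + x)‖) atTop (𝓝 0)

/-- The sequence whose limit is the right fractional sum of `f` from `a` to `b`. -/
noncomputable def rightFracSeq (f : ℂ → ℂ) (p : ℕ → ℂ[X]) (a b : ℂ) (n : ℕ) : ℂ :=
  polyFracSum (p n) (n + a) (n + b) + ∑ ν ∈ Finset.Icc 1 n, (f (ν + a - 1) - f (ν + b))

/-- `f : U → ℂ` is right summable: it is a right approximate polynomial of some degree, and for
all `a` and `b` with `a ∈ U` and `b + 1 ∈ U` the limit that defines the fractional sum exists. -/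
def IsRightSummable (U : Set ℂ) (f : ℂ → ℂ) : Prop :=
  ∃ (σ : WithBot ℕ) (p : ℕ → ℂ[X]), IsRightApproxBy U f σ p ∧
    ∀ a b : ℂ, a ∈ U → b + 1 ∈ U → ∃ L : ℂ, Tendsto (rightFracSeq f p a b) atTop (𝓝 L)

/-- `f : U → ℂ` is right summable and its right fractional sum from `a` to `b` is `S`, whatever
approximating polynomials are used to compute it. -/
structure HasRightFracSum (U : Set ℂ) (f : ℂ → ℂ) (a b S : ℂ) : Prop where
  left_mem : a ∈ U
  right_mem : b + 1 ∈ U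
  summable : IsRightSummable U f
  tendsto : ∀ (σ : WithBot ℕ) (p : ℕ → ℂ[X]), IsRightApproxBy U f σ p →
    Tendsto (rightFracSeq f p a b) atTop (𝓝 S)

/-- The complex numbers other than `0, -1, -2, ...`, the domain of the power functions. -/
def powerDomain : Set ℂ := {z | ∀ k : ℕ, z ≠ -(k : ℂ)}

/-!
For each degree `N`, the fractional sum of a polynomial of degree at most `N` over `n + x, …, n + y`
is a fixed linear combination of its values at `n + 1, …, n + N + 1`, with weights independent of `n`
(`exists_weights_polyFracSum`, by Lagrange interpolation and translation invariance). Two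
approximating sequences of bounded degree have values at these nodes that differ by a null sequence,
so they produce the same fractional sum (`tendsto_rightFracSeq_sub`). It is therefore enough to
compute with one convenient approximation.

For `ν ^ a` this is the Taylor polynomial of degree `N` at `n + 1`. By the binomial series its error
near `n` is `O((n + 1) ^ (Re a - N - 1))`, locally uniformly in `a`, which is `O((n + 1) ^ (-2))`
once `N` exceeds a bound for `|a|` by one (`cpow_sub_powTaylor_isBigO`). Consecutive terms of the sequence defining the fractional sum differ
by a fixed linear combination of such errors, so for large `N` the increments are summable: the
limit exists for all endpoints, and it is holomorphic in `a`
(`exists_differentiableOn_tendsto_rightFracSeq`).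

For `Re a < -1` the Taylor polynomials tend to zero at the nodes and may be dropped. The fractional
sum from `1` to `-1 / 2` is then `∑ ν ^ a - ∑ (ν - 1 / 2) ^ a` over `ν ≥ 1`. The second series is
`2 ^ (-a)` times the sum over odd numbers, that is `(2 ^ (-a) - 1) ζ(-a)`, which gives
`(2 - 2 ^ (-a)) ζ(-a)`. Both sides continue analytically, hence the value for every `a ≠ -1`
(`tendsto_rightFracSeq_powTaylor`). For `a = 2 n` with `n ≥ 1` it vanishes with `ζ(-2 n)`.
-/

/-! ### Fractional sums of polynomials -/

theorem polySummation_eq {p Q : ℂ[X]}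
    (h : ∀ n : ℕ, ∑ ν ∈ Finset.Icc 1 n, p.eval (ν : ℂ) = Q.eval (n : ℂ)) :
    polySummation p = Q :=
  (existsUnique_polySummation p).unique (polySummation_spec p) h

theorem polySummation_add (p q : ℂ[X]) :
    polySummation (p + q) = polySummation p + polySummation q :=
  polySummation_eq fun n => by
    simp only [eval_add, Finset.sum_add_distrib, polySummation_spec]

theorem polySummation_smul (c : ℂ) (p : ℂ[X]) :
    polySummation (c • p) = c • polySummation p :=
  polySummation_eq fun n => by
    simp only [eval_smul, ← Finset.smul_sum, polySummation_spec]

/-- The difference equation that characterizes the summation polynomial holds at all complex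
arguments, because it holds at the natural numbers. -/
theorem polySummation_eval_add_one (p : ℂ[X]) (x : ℂ) :
    (polySummation p).eval (x + 1) = (polySummation p).eval x + p.eval (x + 1) := by
  have h : (polySummation p).comp (X + 1) = polySummation p + p.comp (X + 1) := by
    refine Polynomial.eq_of_infinite_eval_eq _ _
      ((Set.infinite_range_of_injective (Nat.cast_injective (R := ℂ))).mono ?_)
    rintro _ ⟨n, rfl⟩
    have h1 := polySummation_spec p (n + 1)
    rw [Finset.sum_Icc_succ_top (by omega), polySummation_spec] at h1
    push_cast at h1
    simp [h1]
  simpa using congrArg (Polynomial.eval x) h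

/-- `polyFracSum p x y` as a linear functional of `p`. -/
noncomputable def polyFracSumLinear (x y : ℂ) : ℂ[X] →ₗ[ℂ] ℂ where
  toFun p := polyFracSum p x y
  map_add' p q := by simp only [polyFracSum, polySummation_add, eval_add]; ring
  map_smul' c p := by
    simp only [polyFracSum, polySummation_smul, eval_smul, smul_eq_mul, RingHom.id_apply]; ring

theorem polyFracSumLinear_apply (x y : ℂ) (p : ℂ[X]) :
    polyFracSumLinear x y p = polyFracSum p x y := rfl

theorem polyFracSum_sub (p q : ℂ[X]) (x y : ℂ) :
    polyFracSum (p - q) x y = polyFracSum p x y - polyFracSum q x y :=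
  map_sub (polyFracSumLinear x y) p q

theorem polyFracSum_add_one (p : ℂ[X]) (x y : ℂ) :
    polyFracSum p (x + 1) (y + 1) = polyFracSum p x y + p.eval (y + 1) - p.eval x := by
  have h := polySummation_eval_add_one p (x - 1)
  rw [sub_add_cancel] at h
  rw [polyFracSum, polyFracSum, polySummation_eval_add_one, add_sub_cancel_right, h]
  ring

theorem polySummation_comp_X_add_C (p : ℂ[X]) (c : ℂ) :
    polySummation (p.comp (X + C c)) =
      (polySummation p).comp (X + C c) - C ((polySummation p).eval c) := by
  refine polySummation_eq fun n => ?_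
  induction n with
  | zero => simp
  | succ n ih =>
    rw [Finset.sum_Icc_succ_top (by omega), ih]
    have h := polySummation_eval_add_one p (n + c)
    simp only [eval_sub, eval_comp, eval_add, eval_X, eval_C]
    push_cast
    rw [add_right_comm (n : ℂ) 1 c, h]
    ring

theorem polyFracSum_add_left (p : ℂ[X]) (c x y : ℂ) :
    polyFracSum p (c + x) (c + y) = polyFracSum (p.comp (X + C c)) x y := by
  simp only [polyFracSum, polySummation_comp_X_add_C, eval_sub, eval_comp, eval_add, eval_X, eval_C]
  rw [add_comm c y, show c + x - 1 = x - 1 + c by ring]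
  ring

/-- On polynomials of degree at most `N`, the fractional sum is a fixed linear combination of the
values at `N + 1` nodes (by Lagrange interpolation), and this rule is invariant under
translation. -/
theorem exists_weights_polyFracSum (N : ℕ) (x y : ℂ) :
    ∃ w : ℕ → ℂ, ∀ p : ℂ[X], p.degree ≤ N → ∀ c : ℂ,
      polyFracSum p (c + x) (c + y) =
        ∑ i ∈ Finset.range (N + 1), w i * p.eval (c + ((i : ℂ) + 1)) := by
  let v : ℕ → ℂ := fun i => (i : ℂ) + 1
  have hv : Set.InjOn v (Finset.range (N + 1) : Finset ℕ) := fun i _ j _ h => by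
    simpa [v] using h
  refine ⟨fun i => polyFracSum (Lagrange.basis (Finset.range (N + 1)) v i) x y,
    fun p hp c => ?_⟩
  have hdeg : (p.comp (X + C c)).degree < (Finset.range (N + 1)).card := by
    rw [Finset.card_range]
    refine lt_of_le_of_lt (b := (N : WithBot ℕ)) ?_ (by exact_mod_cast Nat.lt_succ_self N)
    refine degree_le_of_natDegree_le ?_
    rw [natDegree_comp, natDegree_X_add_C, mul_one]
    exact natDegree_le_of_degree_le hp
  have h := Lagrange.eq_interpolate hv hdeg
  rw [polyFracSum_add_left, h, ← polyFracSumLinear_apply, Lagrange.interpolate_apply, map_sum]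
  refine Finset.sum_congr rfl fun i _ => ?_
  rw [← smul_eq_C_mul, map_smul, polyFracSumLinear_apply, smul_eq_mul, mul_comm]
  simp [v, add_comm]

/-- Two sequences of polynomials of bounded degree that asymptotically agree near `n` yield the
same fractional sum. -/
theorem tendsto_rightFracSeq_sub (f : ℂ → ℂ) {p q : ℕ → ℂ[X]} {N : ℕ}
    (hp : ∀ n, (p n).degree ≤ N) (hq : ∀ n, (q n).degree ≤ N)
    (h : ∀ i : ℕ, Tendsto (fun n : ℕ =>
      (p n).eval ((n : ℂ) + (i + 1)) - (q n).eval ((n : ℂ) + (i + 1))) atTop (𝓝 0)) (x y : ℂ) :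
    Tendsto (fun n => rightFracSeq f p x y n - rightFracSeq f q x y n) atTop (𝓝 0) := by
  obtain ⟨w, hw⟩ := exists_weights_polyFracSum N x y
  have hsum : Tendsto (fun n : ℕ => ∑ i ∈ Finset.range (N + 1), w i *
      ((p n).eval ((n : ℂ) + (i + 1)) - (q n).eval ((n : ℂ) + (i + 1)))) atTop (𝓝 0) := by
    simpa using tendsto_finsetSum (Finset.range (N + 1)) fun i _ => (h i).const_mul (w i)
  refine hsum.congr fun n => ?_
  simp only [rightFracSeq, hw _ (hp n), hw _ (hq n), mul_sub, Finset.sum_sub_distrib]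
  ring

theorem rightFracSeq_succ_sub (f : ℂ → ℂ) (p : ℕ → ℂ[X]) (x y : ℂ) (n : ℕ) :
    rightFracSeq f p x y (n + 1) - rightFracSeq f p x y n =
      polyFracSum (p (n + 1) - p n) (((n : ℂ) + 1) + x) (((n : ℂ) + 1) + y) +
        (f (n + x) - (p n).eval (n + x)) -
        (f (n + (y + 1)) - (p n).eval (n + (y + 1))) := by
  have h := polyFracSum_add_one (p n) (n + x) (n + y)
  simp only [rightFracSeq, Finset.sum_Icc_succ_top (Nat.le_add_left 1 n), polyFracSum_sub]
  push_cast
  rw [show (n : ℂ) + 1 + x = n + x + 1 by ring, show (n : ℂ) + 1 + y = n + y + 1 by ring, h,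
    show (n : ℂ) + x + 1 - 1 = n + x by ring, show (n : ℂ) + (y + 1) = n + y + 1 by ring]
  ring

/-! ### The binomial series and Taylor polynomials of powers -/

theorem succ_mul_ringChoose_succ (a : ℂ) (k : ℕ) :
    ((k : ℂ) + 1) * Ring.choose a (k + 1) = Ring.choose a k * (a - k) := by
  have h := Ring.choose_smul_choose a (Nat.le_succ k)
  rw [Nat.succ_eq_add_one, Nat.choose_succ_self_right, Nat.add_sub_cancel_left,
    Ring.choose_one_right, nsmul_eq_mul] at h
  simpa using h

theorem ringChoose_ne_zero {a : ℂ} (ha : ∀ d : ℕ, a ≠ d) (k : ℕ) : Ring.choose a k ≠ 0 := by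
  induction k with
  | zero => simp
  | succ k ih =>
    intro h
    have h1 := succ_mul_ringChoose_succ a k
    rw [h, mul_zero] at h1
    exact mul_ne_zero ih (sub_ne_zero.2 (ha k)) h1.symm

theorem differentiable_ringChoose (k : ℕ) : Differentiable ℂ fun a : ℂ => Ring.choose a k := by
  induction k with
  | zero => simp
  | succ k ih =>
    have h : (fun a : ℂ => Ring.choose a (k + 1)) =
        fun a => Ring.choose a k * (a - k) / ((k : ℂ) + 1) := by
      funext a
      rw [← succ_mul_ringChoose_succ, mul_div_cancel_left₀ _ (Nat.cast_add_one_ne_zero k)]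
    rw [h]
    fun_prop

theorem norm_ringChoose_le {a : ℂ} {R : ℕ} (ha : ‖a‖ ≤ R) (k : ℕ) :
    ‖Ring.choose a k‖ ≤ ((k + R).choose R : ℕ) := by
  induction k with
  | zero => simp
  | succ k ih =>
    have hk : (0 : ℝ) < k + 1 := by positivity
    have h1 : ((k : ℝ) + 1) * ‖Ring.choose a (k + 1)‖ = ‖Ring.choose a k‖ * ‖a - k‖ := by
      rw [← norm_mul, ← succ_mul_ringChoose_succ, norm_mul]
      norm_cast
    have h2 : ((k : ℝ) + 1) * ((k + 1 + R).choose R : ℕ) =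
        ((k + R).choose R : ℕ) * (k + 1 + R) := by
      have h := Nat.choose_mul_succ_eq (k + R) R
      rw [show k + R + 1 - R = k + 1 by omega, show k + R + 1 = k + 1 + R by omega] at h
      have h' : (((k + R).choose R * (k + 1 + R) : ℕ) : ℝ) =
        (((k + 1 + R).choose R * (k + 1) : ℕ) : ℝ) := by rw [h]
      push_cast at h'
      linarith
    have h3 : ‖a - k‖ ≤ k + 1 + R := by
      have := norm_sub_le a (k : ℂ)
      rw [Complex.norm_natCast] at this
      linarith
    refine le_of_mul_le_mul_left ?_ hk
    rw [h1, h2]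
    gcongr

theorem hasSum_ringChoose_mul_pow (a : ℂ) {z : ℂ} (hz : ‖z‖ < 1) :
    HasSum (fun k => Ring.choose a k * z ^ k) ((1 + z) ^ a) := by
  have h := (Complex.one_add_cpow_hasFPowerSeriesOnBall_zero (a := a)).hasSum (y := z) (by
    rw [← ENNReal.ofReal_one, Metric.eball_ofReal]; simpa using hz)
  rw [zero_add] at h
  refine h.congr_fun fun k => ?_
  rw [binomialSeries_apply, List.ofFn_const, List.prod_replicate, smul_eq_mul]

/-- The remainder of the binomial series, uniformly in the exponent. -/
theorem exists_norm_one_add_cpow_sub_le (R M : ℕ) :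
    ∃ K : ℝ, 0 ≤ K ∧ ∀ a : ℂ, ‖a‖ ≤ R → ∀ z : ℂ, ‖z‖ ≤ 1 / 2 →
      ‖(1 + z) ^ a - ∑ k ∈ Finset.range M, Ring.choose a k * z ^ k‖ ≤ K * ‖z‖ ^ M := by
  have hs : Summable fun k : ℕ => ((k + M + R).choose R : ℝ) * (1 / 2) ^ k := by
    have h := summable_choose_mul_geometric_of_norm_lt_one R (r := (1 / 2 : ℝ)) (by norm_num)
    refine (((summable_nat_add_iff M).2 h).mul_right (2 ^ M)).congr fun k => ?_
    rw [pow_add, mul_assoc, mul_assoc, ← mul_pow]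
    norm_num
  refine ⟨∑' k : ℕ, ((k + M + R).choose R : ℝ) * (1 / 2) ^ k, tsum_nonneg fun k => by positivity,
    fun a ha z hz => ?_⟩
  have h1 := (hasSum_nat_add_iff' M).2 (hasSum_ringChoose_mul_pow a (hz.trans_lt (by norm_num)))
  refine h1.norm_le_of_bounded (hs.hasSum.mul_right (‖z‖ ^ M)) fun k => ?_
  rw [norm_mul, norm_pow, pow_add, ← mul_assoc]
  gcongr
  exact norm_ringChoose_le ha _

/-- The Taylor polynomial of degree at most `N` of `ν ↦ ν ^ a` at `ν = n + 1`. (The center is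
`n + 1` and not `n`, so that `n = 0` is no exception.) -/
noncomputable def powTaylor (N : ℕ) (a : ℂ) (n : ℕ) : ℂ[X] :=
  ∑ k ∈ Finset.range (N + 1),
    C (((n : ℂ) + 1) ^ a * (Ring.choose a k / ((n : ℂ) + 1) ^ k)) * (X - C ((n : ℂ) + 1)) ^ k

theorem degree_C_mul_X_sub_C_pow_le (c b : ℂ) (k : ℕ) :
    (C c * (X - C b) ^ k).degree ≤ (k : WithBot ℕ) := by
  rw [← smul_eq_C_mul]
  exact (degree_smul_le c _).trans (by rw [degree_pow, degree_X_sub_C, nsmul_one])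

theorem degree_powTaylor_le (N : ℕ) (a : ℂ) (n : ℕ) : (powTaylor N a n).degree ≤ N := by
  refine (degree_sum_le _ _).trans (Finset.sup_le fun k hk => ?_)
  refine (degree_C_mul_X_sub_C_pow_le _ _ k).trans ?_
  exact_mod_cast Nat.lt_succ_iff.1 (Finset.mem_range.1 hk)

theorem degree_powTaylor {a : ℂ} (ha : ∀ d : ℕ, a ≠ d) (N n : ℕ) :
    (powTaylor N a n).degree = N := by
  have hn : (n : ℂ) + 1 ≠ 0 := Nat.cast_add_one_ne_zero n
  have hlead : (C (((n : ℂ) + 1) ^ a * (Ring.choose a N / ((n : ℂ) + 1) ^ N)) *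
      (X - C ((n : ℂ) + 1)) ^ N).degree = (N : WithBot ℕ) := by
    rw [degree_C_mul, degree_pow, degree_X_sub_C, nsmul_one]
    exact mul_ne_zero ((Complex.cpow_ne_zero_iff_of_exponent_ne_zero
      (by simpa using ha 0)).2 hn) (div_ne_zero (ringChoose_ne_zero ha N) (pow_ne_zero N hn))
  rw [powTaylor, Finset.sum_range_succ, degree_add_eq_right_of_degree_lt, hlead]
  rw [hlead]
  refine (degree_sum_le _ _).trans_lt ((Finset.sup_lt_iff (WithBot.bot_lt_coe N)).2 fun k hk => ?_)
  exact (degree_C_mul_X_sub_C_pow_le _ _ k).trans_lt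
    (WithBot.coe_lt_coe.2 (Finset.mem_range.1 hk))

theorem differentiable_powTaylor_eval (N n : ℕ) (x : ℂ) :
    Differentiable ℂ fun a => (powTaylor N a n).eval x := by
  have hn : (n : ℂ) + 1 ≠ 0 := Nat.cast_add_one_ne_zero n
  simp only [powTaylor, eval_finsetSum, eval_mul, eval_C]
  have h := differentiable_ringChoose
  have h2 : Differentiable ℂ fun a : ℂ => ((n : ℂ) + 1) ^ a :=
    differentiable_id.const_cpow (Or.inl hn)
  exact Differentiable.fun_sum fun k _ => (h2.mul ((h k).div_const _)).mul_const _

/-- For large `n`, the factor `(n + 1) ^ a` reduces the distance of `ν ^ a` from its Taylor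
polynomial near `n` to the remainder of the binomial series at `(x - 1) / (n + 1)`. -/
theorem cpow_sub_powTaylor_eval (N : ℕ) (a x : ℂ) (n : ℕ) (hx : ‖x - 1‖ / ((n : ℝ) + 1) ≤ 1 / 2) :
    ((n : ℂ) + x) ^ a - (powTaylor N a n).eval (n + x) =
      ((n : ℂ) + 1) ^ a * ((1 + (x - 1) / ((n : ℂ) + 1)) ^ a -
        ∑ k ∈ Finset.range (N + 1), Ring.choose a k * ((x - 1) / ((n : ℂ) + 1)) ^ k) := by
  have hn : (n : ℂ) + 1 ≠ 0 := Nat.cast_add_one_ne_zero n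
  have hnr : (0 : ℝ) < (n : ℝ) + 1 := by positivity
  have hz : ‖(x - 1) / ((n : ℂ) + 1)‖ ≤ 1 / 2 := by
    rw [norm_div]
    convert hx
    norm_cast
  have hz1 : 1 + (x - 1) / ((n : ℂ) + 1) ≠ 0 := by
    intro h
    have : ‖(x - 1) / ((n : ℂ) + 1)‖ = 1 := by
      rw [eq_neg_of_add_eq_zero_right h]; simp
    linarith
  have h1 : (n : ℂ) + x = ((n : ℂ) + 1) * (1 + (x - 1) / ((n : ℂ) + 1)) := by
    field_simp; ring
  have h2 : ((n : ℂ) + x) ^ a = ((n : ℂ) + 1) ^ a * (1 + (x - 1) / ((n : ℂ) + 1)) ^ a := by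
    have hlog := Complex.log_ofReal_mul hnr hz1
    rw [Complex.ofReal_log hnr.le] at hlog
    push_cast at hlog
    rw [h1, Complex.cpow_def_of_ne_zero (mul_ne_zero hn hz1), Complex.cpow_def_of_ne_zero hn,
      Complex.cpow_def_of_ne_zero hz1, hlog, ← Complex.exp_add]
    ring_nf
  rw [h2, mul_sub, powTaylor, eval_finsetSum, Finset.mul_sum]
  congr 1
  refine Finset.sum_congr rfl fun k _ => ?_
  simp only [eval_mul, eval_C, eval_pow, eval_sub, eval_X]
  rw [show (n : ℂ) + x - (n + 1) = x - 1 by ring, div_pow]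
  ring

/-- For `N > R`, the Taylor polynomials of degree `N` approximate `ν ^ a` near `n` with an error
that is summable over `n`, uniformly for `‖a‖ < R`. -/
theorem cpow_sub_powTaylor_isBigO {R N : ℕ} (hN : R + 1 ≤ N) (x : ℂ) :
    (fun q : ℕ × ℂ => ((q.1 : ℂ) + x) ^ q.2 - (powTaylor N q.2 q.1).eval ((q.1 : ℂ) + x))
      =O[atTop ×ˢ 𝓟 (Metric.ball 0 R)] fun q => (((q.1 : ℝ) + 1) ^ 2)⁻¹ := by
  obtain ⟨K, hK0, hK⟩ := exists_norm_one_add_cpow_sub_le R (N + 1)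
  refine Asymptotics.IsBigO.of_bound (K * ‖x - 1‖ ^ (N + 1)) ?_
  rw [eventually_prod_principal_iff]
  have hlim : Tendsto (fun n : ℕ => ‖x - 1‖ / ((n : ℝ) + 1)) atTop (𝓝 0) :=
    tendsto_const_nhds.div_atTop (tendsto_atTop_add_const_right _ _ tendsto_natCast_atTop_atTop)
  filter_upwards [hlim.eventually (ge_mem_nhds (show (0 : ℝ) < 1 / 2 by norm_num))] with n hn a ha
  have hnr : (1 : ℝ) ≤ (n : ℝ) + 1 := by linarith [(Nat.cast_nonneg n : (0 : ℝ) ≤ n)]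
  have hnc : ((n : ℂ) + 1) = (((n : ℝ) + 1 : ℝ) : ℂ) := by push_cast; rfl
  have ha' : ‖a‖ ≤ R := by simpa using (Metric.mem_ball.1 ha).le
  have hz : ‖(x - 1) / ((n : ℂ) + 1)‖ = ‖x - 1‖ / ((n : ℝ) + 1) := by
    rw [norm_div, hnc, Complex.norm_real, Real.norm_of_nonneg (by linarith)]
  have h1 := hK a ha' ((x - 1) / ((n : ℂ) + 1)) (hz.trans_le hn)
  have h2 : ‖((n : ℂ) + 1) ^ a‖ ≤ ((n : ℝ) + 1) ^ R := by
    rw [hnc, Complex.norm_cpow_eq_rpow_re_of_pos (by linarith), ← Real.rpow_natCast]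
    exact Real.rpow_le_rpow_of_exponent_le hnr ((Complex.re_le_norm a).trans ha')
  have h4 : ((n : ℝ) + 1) ^ R / ((n : ℝ) + 1) ^ (N + 1) ≤ (((n : ℝ) + 1) ^ 2)⁻¹ := by
    rw [div_le_iff₀ (by positivity), inv_mul_eq_div, le_div_iff₀ (by positivity), ← pow_add]
    exact pow_le_pow_right₀ hnr (by omega)
  rw [cpow_sub_powTaylor_eval N a x n hn, norm_mul, Real.norm_of_nonneg (by positivity)]
  calc _ ≤ ((n : ℝ) + 1) ^ R * (K * (‖x - 1‖ / ((n : ℝ) + 1)) ^ (N + 1)) := by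
        rw [hz] at h1; gcongr
    _ = K * ‖x - 1‖ ^ (N + 1) * (((n : ℝ) + 1) ^ R / ((n : ℝ) + 1) ^ (N + 1)) := by
        rw [div_pow]; ring
    _ ≤ _ := by gcongr

/-! ### Holomorphic dependence on the exponent -/

theorem rightFracSeq_powTaylor_succ_sub_isBigO {R N : ℕ} (hN : R + 1 ≤ N) (x y : ℂ) :
    (fun q : ℕ × ℂ => rightFracSeq (fun ν => ν ^ q.2) (powTaylor N q.2) x y (q.1 + 1) -
        rightFracSeq (fun ν => ν ^ q.2) (powTaylor N q.2) x y q.1)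
      =O[atTop ×ˢ 𝓟 (Metric.ball 0 R)] fun q => (((q.1 : ℝ) + 1) ^ 2)⁻¹ := by
  obtain ⟨w, hw⟩ := exists_weights_polyFracSum N x y
  have hshift : Tendsto (fun q : ℕ × ℂ => (q.1 + 1, q.2)) (atTop ×ˢ 𝓟 (Metric.ball 0 (R : ℝ)))
      (atTop ×ˢ 𝓟 (Metric.ball 0 (R : ℝ))) :=
    (tendsto_add_atTop_nat 1).prodMap tendsto_id
  have hmono : (fun q : ℕ × ℂ => ((((q.1 + 1 : ℕ) : ℝ) + 1) ^ 2)⁻¹)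
      =O[atTop ×ˢ 𝓟 (Metric.ball 0 (R : ℝ))] fun q => (((q.1 : ℝ) + 1) ^ 2)⁻¹ := by
    refine Asymptotics.IsBigO.of_bound 1 (Eventually.of_forall fun q => ?_)
    rw [one_mul, Real.norm_of_nonneg (by positivity), Real.norm_of_nonneg (by positivity)]
    push_cast
    gcongr
    linarith
  -- Both `p n` and `p (n + 1)` approximate `f` near `n + 1`, so their difference there is as small
  -- as the approximation errors.
  have hnode (i : ℕ) : (fun q : ℕ × ℂ =>
      (powTaylor N q.2 (q.1 + 1) - powTaylor N q.2 q.1).eval ((q.1 : ℂ) + 1 + ((i : ℂ) + 1)))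
      =O[atTop ×ˢ 𝓟 (Metric.ball 0 (R : ℝ))] fun q => (((q.1 : ℝ) + 1) ^ 2)⁻¹ := by
    refine ((cpow_sub_powTaylor_isBigO hN ((i : ℂ) + 2)).sub
      (((cpow_sub_powTaylor_isBigO hN ((i : ℂ) + 1)).comp_tendsto hshift).trans hmono)).congr_left
      fun q => ?_
    simp only [Function.comp_apply, eval_sub]
    push_cast
    rw [show (q.1 : ℂ) + (i + 2) = q.1 + 1 + (i + 1) by ring]
    ring
  have hsum := Asymptotics.IsBigO.sum (s := Finset.range (N + 1))
    fun i _ => (hnode i).const_mul_left (w i)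
  refine ((hsum.add (cpow_sub_powTaylor_isBigO hN x)).sub
    (cpow_sub_powTaylor_isBigO hN (y + 1))).congr_left fun q => ?_
  rw [rightFracSeq_succ_sub, hw _ ((degree_sub_le _ _).trans
    (max_le (degree_powTaylor_le _ _ _) (degree_powTaylor_le _ _ _))), Finset.sum_apply]

theorem differentiable_rightFracSeq_powTaylor (N : ℕ) {x y : ℂ} (hx : x ∈ powerDomain)
    (hy : y + 1 ∈ powerDomain) (n : ℕ) :
    Differentiable ℂ fun a => rightFracSeq (fun ν => ν ^ a) (powTaylor N a) x y n := by
  obtain ⟨w, hw⟩ := exists_weights_polyFracSum N x y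
  simp only [rightFracSeq, hw _ (degree_powTaylor_le _ _ _)]
  refine (Differentiable.fun_sum fun i _ =>
    (differentiable_powTaylor_eval N n _).const_mul _).add
    (Differentiable.fun_sum fun ν hν => ?_)
  obtain ⟨k, rfl⟩ : ∃ k, ν = k + 1 := ⟨ν - 1, by have := (Finset.mem_Icc.1 hν).1; omega⟩
  refine (differentiable_id.const_cpow (Or.inl fun h => hx k ?_)).sub
    (differentiable_id.const_cpow (Or.inl fun h => hy k ?_)) <;>
  · push_cast at h
    linear_combination h

/-- The fractional sums of the powers `ν ^ a`, as computed with Taylor polynomials of a fixed degree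
`N > R`, exist for `‖a‖ < R` and depend holomorphically on `a`. -/
theorem exists_differentiableOn_tendsto_rightFracSeq {R N : ℕ} (hN : R + 1 ≤ N) {x y : ℂ}
    (hx : x ∈ powerDomain) (hy : y + 1 ∈ powerDomain) :
    ∃ L : ℂ → ℂ, DifferentiableOn ℂ L (Metric.ball 0 R) ∧ ∀ a ∈ Metric.ball (0 : ℂ) R,
      Tendsto (rightFracSeq (fun ν => ν ^ a) (powTaylor N a) x y) atTop (𝓝 (L a)) := by
  obtain ⟨K, hK⟩ := (rightFracSeq_powTaylor_succ_sub_isBigO hN x y).bound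
  rw [eventually_prod_principal_iff, eventually_atTop] at hK
  obtain ⟨n₀, hn₀⟩ := hK
  let s : ℕ → ℂ → ℂ := fun n a => rightFracSeq (fun ν => ν ^ a) (powTaylor N a) x y n
  have hs (n : ℕ) : Differentiable ℂ (s n) := differentiable_rightFracSeq_powTaylor N hx hy n
  let d : ℕ → ℂ → ℂ := fun n a => s (n + 1 + n₀) a - s (n + n₀) a
  let u : ℕ → ℝ := fun n => K * ‖(((((n + n₀ : ℕ) : ℝ)) + 1) ^ 2)⁻¹‖
  have hu : Summable u := by
    have h2 : Summable fun n : ℕ => ((n : ℝ) ^ 2)⁻¹ := Real.summable_nat_pow_inv.2 one_lt_two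
    refine (((summable_nat_add_iff (n₀ + 1)).2 h2).norm.mul_left K).congr fun n => ?_
    simp only [u]
    push_cast
    ring_nf
  have hd (n : ℕ) (a : ℂ) (ha : a ∈ Metric.ball (0 : ℂ) R) : ‖d n a‖ ≤ u n := by
    have h := hn₀ (n + n₀) (Nat.le_add_left _ _) a ha
    simpa only [d, s, u, add_right_comm n 1 n₀] using h
  refine ⟨fun a => (∑' n, d n a) + s n₀ a,
    (Complex.differentiableOn_tsum_of_summable_norm hu
      (fun n => ((hs _).sub (hs _)).differentiableOn) Metric.isOpen_ball hd).add
      (hs n₀).differentiableOn, fun a ha => ?_⟩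
  have hsum : Summable fun n => d n a := Summable.of_norm_bounded hu fun n => hd n a ha
  have ht := hsum.hasSum.tendsto_sum_nat.add_const (s n₀ a)
  rw [← tendsto_add_atTop_iff_nat n₀]
  refine ht.congr fun n => ?_
  rw [Finset.sum_range_sub (fun n => s (n + n₀) a) n, zero_add, sub_add_cancel]

/-! ### Summability and independence of the approximation -/

theorem tendsto_cpow_sub_powTaylor {R N : ℕ} (hN : R + 1 ≤ N) {a : ℂ}
    (ha : a ∈ Metric.ball (0 : ℂ) R) (x : ℂ) :
    Tendsto (fun n : ℕ => ((n : ℂ) + x) ^ a - (powTaylor N a n).eval ((n : ℂ) + x))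
      atTop (𝓝 0) := by
  have hpair : Tendsto (fun n : ℕ => (n, a)) atTop (atTop ×ˢ 𝓟 (Metric.ball 0 (R : ℝ))) :=
    tendsto_id.prodMk (tendsto_principal.2 (Eventually.of_forall fun _ => ha))
  refine ((cpow_sub_powTaylor_isBigO hN x).comp_tendsto hpair).trans_tendsto ?_
  have h : Tendsto (fun n : ℕ => (n : ℝ) + 1) atTop atTop :=
    tendsto_atTop_add_const_right _ _ tendsto_natCast_atTop_atTop
  exact tendsto_inv_atTop_zero.comp ((tendsto_pow_atTop two_ne_zero).comp h)

theorem add_one_mem_powerDomain {u : ℂ} (hu : u ∈ powerDomain) : u + 1 ∈ powerDomain :=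
  fun k h => hu (k + 1) (by push_cast; linear_combination h)

theorem natCast_add_one_mem_powerDomain (i : ℕ) : (i : ℂ) + 1 ∈ powerDomain := fun k h => by
  have h' : ((i + 1 + k : ℕ) : ℂ) = 0 := by push_cast; linear_combination h
  rw [Nat.cast_eq_zero] at h'
  omega

/-- Whatever polynomials approximate `ν ^ a`, the fractional sums agree with those computed with
Taylor polynomials of sufficiently high degree. -/
theorem IsRightApproxBy.exists_tendsto_of_powTaylor {a : ℂ} {σ : WithBot ℕ} {p : ℕ → ℂ[X]}
    (h : IsRightApproxBy powerDomain (fun ν => ν ^ a) σ p) {R : ℕ}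
    (ha : a ∈ Metric.ball (0 : ℂ) R) :
    ∃ N : ℕ, R + 1 ≤ N ∧ ∀ x y S : ℂ,
      Tendsto (rightFracSeq (fun ν => ν ^ a) (powTaylor N a) x y) atTop (𝓝 S) →
      Tendsto (rightFracSeq (fun ν => ν ^ a) p x y) atTop (𝓝 S) := by
  have hdeg : ∃ M : ℕ, ∀ n, (p n).degree ≤ M := by
    refine ⟨(p 0).natDegree, fun n => ?_⟩
    rw [h.degree_eq n, ← h.degree_eq 0]
    exact degree_le_natDegree
  obtain ⟨M, hM⟩ := hdeg
  have hN : R + 1 ≤ max M (R + 1) := le_max_right _ _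
  refine ⟨max M (R + 1), hN, fun x y S hS => ?_⟩
  have hsub := tendsto_rightFracSeq_sub (fun ν => ν ^ a) (N := max M (R + 1))
    (fun n => (hM n).trans (by exact_mod_cast le_max_left M (R + 1)))
    (fun n => degree_powTaylor_le _ a n) (fun i => ?_) x y
  · simpa using hsub.add hS
  · have h1 := tendsto_zero_iff_norm_tendsto_zero.2
      (h.approx _ (natCast_add_one_mem_powerDomain i))
    simpa using (tendsto_cpow_sub_powTaylor hN ha ((i : ℂ) + 1)).sub h1

theorem exists_isRightApproxBy_cpow (a : ℂ) :
    ∃ (σ : WithBot ℕ) (p : ℕ → ℂ[X]), IsRightApproxBy powerDomain (fun ν => ν ^ a) σ p := by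
  by_cases hd : ∃ d : ℕ, a = d
  · obtain ⟨d, rfl⟩ := hd
    exact ⟨d, fun _ => X ^ d, fun u => add_one_mem_powerDomain, fun _ => degree_X_pow d,
      fun x _ => by simp⟩
  · push Not at hd
    obtain ⟨R, hR⟩ := exists_nat_gt ‖a‖
    have ha : a ∈ Metric.ball (0 : ℂ) R := by simpa using hR
    exact ⟨_, powTaylor (R + 1) a, fun u => add_one_mem_powerDomain,
      fun n => degree_powTaylor hd _ n,
      fun x _ => tendsto_zero_iff_norm_tendsto_zero.1 (tendsto_cpow_sub_powTaylor le_rfl ha x)⟩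

theorem isRightSummable_cpow (a : ℂ) : IsRightSummable powerDomain (fun ν => ν ^ a) := by
  obtain ⟨σ, p, hp⟩ := exists_isRightApproxBy_cpow a
  obtain ⟨R, hR⟩ := exists_nat_gt ‖a‖
  have ha : a ∈ Metric.ball (0 : ℂ) R := by simpa using hR
  obtain ⟨N, hN, hpN⟩ := hp.exists_tendsto_of_powTaylor ha
  refine ⟨σ, p, hp, fun x y hx hy => ?_⟩
  obtain ⟨L, -, hL⟩ := exists_differentiableOn_tendsto_rightFracSeq hN hx hy
  exact ⟨L a, hpN x y _ (hL a ha)⟩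

/-! ### The value of the sum from `1` to `-1 / 2` -/

theorem neg_half_add_one_mem_powerDomain : (-1 / 2 : ℂ) + 1 ∈ powerDomain := fun k h => by
  have h' : ((1 + 2 * k : ℕ) : ℂ) = 0 := by push_cast; linear_combination 2 * h
  rw [Nat.cast_eq_zero] at h'
  omega

theorem hasSum_natCast_add_one_cpow {a : ℂ} (ha : a.re < -1) :
    HasSum (fun k : ℕ => ((k : ℂ) + 1) ^ a) (riemannZeta (-a)) := by
  have hs : 1 < (-a).re := by rw [Complex.neg_re]; linarith
  rw [zeta_eq_tsum_one_div_nat_add_one_cpow hs]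
  have h := (summable_nat_add_iff 1).2 (Complex.summable_one_div_nat_cpow.2 hs)
  have heq (k : ℕ) : ((k : ℂ) + 1) ^ a = 1 / ((k : ℂ) + 1) ^ (-a) := by
    rw [Complex.cpow_neg, one_div, inv_inv]
  simp only [heq]
  exact_mod_cast h.hasSum

/-- The terms `(k + 1 / 2) ^ a` are the odd powers `(2 k + 1) ^ a`, scaled by `2 ^ (-a)`. -/
theorem hasSum_natCast_add_half_cpow {a : ℂ} (ha : a.re < -1) :
    HasSum (fun k : ℕ => ((k : ℂ) + 1 / 2) ^ a) (((2 : ℂ) ^ (-a) - 1) * riemannZeta (-a)) := by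
  have hz := hasSum_natCast_add_one_cpow ha
  have h2 : (2 : ℂ) ^ a ≠ 0 := by simp [Complex.cpow_eq_zero_iff]
  have hodd : HasSum (fun k : ℕ => (((2 * k + 1 : ℕ) : ℂ) + 1) ^ a)
      ((2 : ℂ) ^ a * riemannZeta (-a)) := by
    refine (hz.mul_left ((2 : ℂ) ^ a)).congr_fun fun k => ?_
    have h := Complex.natCast_mul_natCast_cpow 2 (k + 1) a
    push_cast at h ⊢
    rw [← h]
    ring_nf
  have heven := (hz.summable.comp_injective (i := fun k : ℕ => 2 * k)
    fun i j h => by simpa using h).hasSum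
  have huniq := (HasSum.even_add_odd (f := fun k : ℕ => ((k : ℂ) + 1) ^ a) heven hodd).unique hz
  have hval : ((2 : ℂ) ^ (-a) - 1) * riemannZeta (-a) =
      (2 : ℂ) ^ (-a) * (riemannZeta (-a) - (2 : ℂ) ^ a * riemannZeta (-a)) := by
    rw [Complex.cpow_neg]
    field_simp
  rw [eq_sub_of_add_eq huniq] at heven
  rw [hval]
  refine (heven.mul_left ((2 : ℂ) ^ (-a))).congr_fun fun k => ?_
  have h := Complex.mul_cpow_ofReal_nonneg (a := 2) (b := (k : ℝ) + 1 / 2) (by norm_num)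
    (by positivity) a
  push_cast at h
  simp only [Function.comp_apply]
  rw [show ((2 * k : ℕ) : ℂ) + 1 = 2 * ((k : ℂ) + 1 / 2) by push_cast; ring, h,
    Complex.cpow_neg, inv_mul_cancel_left₀ h2]

theorem tendsto_natCast_add_cpow {a : ℂ} (ha : a.re < 0) (i : ℕ) :
    Tendsto (fun n : ℕ => ((n : ℂ) + (i + 1)) ^ a) atTop (𝓝 0) := by
  rw [tendsto_zero_iff_norm_tendsto_zero]
  have h : Tendsto (fun n : ℕ => (n : ℝ) + ((i : ℝ) + 1)) atTop atTop :=
    tendsto_atTop_add_const_right _ _ tendsto_natCast_atTop_atTop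
  have h1 := (tendsto_rpow_neg_atTop (neg_pos.2 ha)).comp h
  refine h1.congr fun n => ?_
  have hpos : (0 : ℝ) < (n : ℝ) + (i + 1) := by positivity
  have h2 := Complex.norm_cpow_eq_rpow_re_of_pos hpos a
  push_cast at h2
  rw [h2, neg_neg, Function.comp_apply]

/-- In the half-plane of absolute convergence the approximating polynomials can be dropped, and the
fractional sum is a difference of two ordinary series. -/
theorem tendsto_rightFracSeq_powTaylor_of_re_lt {R N : ℕ} (hN : R + 1 ≤ N) {a : ℂ}
    (ha : a ∈ Metric.ball (0 : ℂ) R) (hre : a.re < -1) :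
    Tendsto (rightFracSeq (fun ν => ν ^ a) (powTaylor N a) 1 (-1 / 2)) atTop
      (𝓝 ((2 - (2 : ℂ) ^ (-a)) * riemannZeta (-a))) := by
  have hzero : Tendsto (rightFracSeq (fun ν => ν ^ a) (fun _ => 0) 1 (-1 / 2)) atTop
      (𝓝 ((2 - (2 : ℂ) ^ (-a)) * riemannZeta (-a))) := by
    have h := ((hasSum_natCast_add_one_cpow hre).sub
      (hasSum_natCast_add_half_cpow hre)).tendsto_sum_nat
    rw [show riemannZeta (-a) - ((2 : ℂ) ^ (-a) - 1) * riemannZeta (-a) =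
      (2 - (2 : ℂ) ^ (-a)) * riemannZeta (-a) by ring] at h
    refine h.congr fun n => ?_
    have h0 (x y : ℂ) : polyFracSum 0 x y = 0 := map_zero (polyFracSumLinear x y)
    rw [rightFracSeq, h0, zero_add]
    induction n with
    | zero => simp
    | succ n ih =>
      rw [Finset.sum_Icc_succ_top (by omega), Finset.sum_range_succ, ih]
      push_cast
      ring_nf
  have hsub := tendsto_rightFracSeq_sub (fun ν => ν ^ a) (N := N)
    (fun n => degree_powTaylor_le N a n) (q := fun _ => 0) (fun n => by simp) (fun i => ?_)
    1 (-1 / 2)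
  · simpa using hsub.add hzero
  · simpa using (tendsto_natCast_add_cpow (hre.trans (by norm_num)) i).sub
      (tendsto_cpow_sub_powTaylor hN ha ((i : ℂ) + 1))

/-- The entire function `s ↦ (s - 1) ζ(s)`. -/
noncomputable def subOneMulZeta : ℂ → ℂ :=
  Function.update (fun s => (s - 1) * riemannZeta s) 1 1

theorem subOneMulZeta_of_ne {s : ℂ} (hs : s ≠ 1) : subOneMulZeta s = (s - 1) * riemannZeta s :=
  Function.update_of_ne hs _ _

theorem differentiable_subOneMulZeta : Differentiable ℂ subOneMulZeta := by
  rw [← differentiableOn_univ,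
    ← Complex.differentiableOn_compl_singleton_and_continuousAt_iff (c := 1) univ_mem]
  refine ⟨fun s hs => ?_, continuousAt_update_same.2 riemannZeta_residue_one⟩
  have hs1 : s ≠ 1 := hs.2
  refine ((((differentiableAt_id.sub_const 1).mul
    (differentiableAt_riemannZeta hs1)).congr_of_eventuallyEq ?_)).differentiableWithinAt
  filter_upwards [isOpen_ne.mem_nhds hs1] with t ht
  exact subOneMulZeta_of_ne ht

/-- Analytic continuation from `Re a < -1`. Multiplication by `-a - 1` removes the pole of
`ζ(-a)` at `a = -1`, so that the identity theorem applies on a whole ball. -/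
theorem tendsto_rightFracSeq_powTaylor {R N : ℕ} (hR : 3 ≤ R) (hN : R + 1 ≤ N) {a : ℂ}
    (ha : a ∈ Metric.ball (0 : ℂ) R) (ha1 : a ≠ -1) :
    Tendsto (rightFracSeq (fun ν => ν ^ a) (powTaylor N a) 1 (-1 / 2)) atTop
      (𝓝 ((2 - (2 : ℂ) ^ (-a)) * riemannZeta (-a))) := by
  have hx : (1 : ℂ) ∈ powerDomain := by simpa using natCast_add_one_mem_powerDomain 0
  obtain ⟨L, hLd, hL⟩ := exists_differentiableOn_tendsto_rightFracSeq hN hx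
    neg_half_add_one_mem_powerDomain
  have hF : AnalyticOnNhd ℂ (fun s => (-s - 1) * L s) (Metric.ball 0 R) := by
    refine DifferentiableOn.analyticOnNhd ?_ Metric.isOpen_ball
    exact (differentiable_neg.sub_const 1).differentiableOn.mul hLd
  have hG : AnalyticOnNhd ℂ (fun s => (2 - (2 : ℂ) ^ (-s)) * subOneMulZeta (-s))
      (Metric.ball 0 R) := by
    refine DifferentiableOn.analyticOnNhd (Differentiable.differentiableOn ?_) Metric.isOpen_ball
    exact ((differentiable_const 2).sub
      (differentiable_neg.const_cpow (Or.inl two_ne_zero))).mul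
      (differentiable_subOneMulZeta.comp differentiable_neg)
  have hne {s : ℂ} (hs : s ≠ -1) : -s ≠ 1 := fun h => hs (by rw [← h, neg_neg])
  have h2 : (-2 : ℂ) ∈ Metric.ball (0 : ℂ) R := by
    have : (3 : ℝ) ≤ R := by exact_mod_cast hR
    simp only [mem_ball_zero_iff, norm_neg, Complex.norm_ofNat]
    linarith
  have hev : (fun s => (-s - 1) * L s) =ᶠ[𝓝 (-2)]
      fun s => (2 - (2 : ℂ) ^ (-s)) * subOneMulZeta (-s) := by
    have hre : ∀ᶠ s : ℂ in 𝓝 (-2), s.re < -1 :=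
      Complex.continuous_re.continuousAt.eventually (gt_mem_nhds (by norm_num))
    filter_upwards [hre, Metric.isOpen_ball.mem_nhds h2] with s hs hsb
    have hs1 : s ≠ -1 := by rintro rfl; simp at hs
    rw [tendsto_nhds_unique (hL s hsb) (tendsto_rightFracSeq_powTaylor_of_re_lt hN hsb hs),
      subOneMulZeta_of_ne (hne hs1)]
    ring
  have heq := hF.eqOn_of_preconnected_of_eventuallyEq hG
    (convex_ball (0 : ℂ) R).isPreconnected h2 hev ha
  have hLa : L a = (2 - (2 : ℂ) ^ (-a)) * riemannZeta (-a) := by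
    refine mul_left_cancel₀ (sub_ne_zero.2 (hne ha1)) ?_
    simp only [subOneMulZeta_of_ne (hne ha1)] at heq
    rw [heq]
    ring
  exact hLa ▸ hL a ha

theorem hasRightFracSum_cpow {a : ℂ} (ha1 : a ≠ -1) :
    HasRightFracSum powerDomain (fun ν => ν ^ a) 1 (-1 / 2)
      ((2 - (2 : ℂ) ^ (-a)) * riemannZeta (-a)) where
  left_mem := by simpa using natCast_add_one_mem_powerDomain 0
  right_mem := neg_half_add_one_mem_powerDomain
  summable := isRightSummable_cpow a
  tendsto σ p hp := by
    obtain ⟨R, hR⟩ := exists_nat_gt (max ‖a‖ 3)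
    have ha : a ∈ Metric.ball (0 : ℂ) R := by simpa using (max_lt_iff.1 hR).1
    obtain ⟨N, hN, hpN⟩ := hp.exists_tendsto_of_powTaylor ha
    exact hpN _ _ _ (tendsto_rightFracSeq_powTaylor
      (by exact_mod_cast (max_lt_iff.1 hR).2.le) hN ha ha1)

theorem mainTheorem8 :
    (∀ a : ℂ, a ≠ -1 →
      HasRightFracSum powerDomain (fun ν : ℂ => ν ^ a) 1 (-1 / 2)
        ((2 - (2 : ℂ) ^ (-a)) * riemannZeta (-a))) ∧
    (∀ n : ℕ, 0 < n →
      HasRightFracSum powerDomain (fun ν : ℂ => ν ^ (2 * n)) 1 (-1 / 2) 0) := by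
  refine ⟨fun a ha => hasRightFracSum_cpow ha, fun n hn => ?_⟩
  obtain ⟨m, rfl⟩ : ∃ m, n = m + 1 := ⟨n - 1, by omega⟩
  have ha : ((2 * (m + 1) : ℕ) : ℂ) ≠ -1 := by
    intro h
    have h' : ((2 * (m + 1) + 1 : ℕ) : ℂ) = 0 := by push_cast at h ⊢; linear_combination h
    exact Nat.cast_ne_zero.2 (Nat.succ_ne_zero _) h'
  have h := hasRightFracSum_cpow ha
  -- The even natural powers are controlled by the trivial zeros of `ζ`.
  rw [show -((2 * (m + 1) : ℕ) : ℂ) = -2 * ((m : ℂ) + 1) by push_cast; ring,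
    riemannZeta_neg_two_mul_nat_add_one, mul_zero] at h
  simpa only [Complex.cpow_natCast] using h
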